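/- Let $n\ge 0$, let $G$ be a discrete group of type $F_{n+1}$, and let $X$ be a simplicial model of $K(G,1)$ with finite $(n+1)$-skeleton: $X=E/G$, where $E$ is a simplicial set with contractible geometric realization on which $G$ acts freely. Let $k_m$ be the number of (nondegenerate) $m$-simplices of $X$, and choose a lift to $E$ of each simplex of $X$ of dimension at most $n+1$. For $m\le n$ let $d_m\in \mathbb{M}_{k_{m+1}\times k_m}(\mathbb{R}G)$ be the matrix of the simplicial codifferential, so that for every unitary representation $\pi$ of $G$ the operator $\pi(d_m)$ is the codifferential $C^m(G,\pi)\to C^{m+1}(G,\pi)$ of the cochain complex of $X$ with coefficients in $\pi$, and let $$\Delta_n=d_n^*d_n+d_{n-1}d_{n-1}^*\in\mathbb{M}_{k_n}(\mathbb{R}G)\subseteq \mathbb{M}_{k_n}(C^*_r(G)),\qquad d_{-1}=0 .$$ Let $\lambda$ be the left regular representation of $G$ on $\ell_2(G)$, and let $C^*_r(G)=\overline{\lambda(\mathbb{C}G)}\subseteq B(\ell_2(G))$ be the reduced group $C^*$-algebra. A (higher) Kazhdan projection in degree $n$ is a projection $p=p^*=p^2\in \mathbb{M}_{k_n}(C^*_r(G))$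 that acts on $C^n(G,\lambda)=\ell_2(G)^{k_n}$ as the orthogonal projection onto $\ker\lambda(\Delta_n)$. Let $\tau_*:K_0(C^*_r(G))\to\mathbb{R}$ be the homomorphism induced by the canonical trace $\tau_G(a)=\langle a\delta_e,\delta_e\rangle$, that is, $\tau_*([p])=\sum_{i}\tau_G(p_{ii})$ for a projection $p$ in a matrix algebra over $C^*_r(G)$. Let $\beta^n_{(2)}(G)$ be the $n$-th $\ell_2$-Betti number of $G$, i.e. the von Neumann dimension over the group von Neumann algebra $L(G)$ of $\ker\lambda(\Delta_n)\subseteq\ell_2(G)^{k_n}$. **Proposition.** Suppose that $\Delta_n$ has a spectral gap in $\mathbb{M}_{k_n}(C^*_r(G))$, i.e. its spectrum is contained in $\{0\}\cup[\epsilon,\infty)$ for some $\epsilon>0$. Then there is exactly one Kazhdan projection $p_n\in\mathbb{M}_{k_n}(C^*_r(G))$ in degree $n$, and its class $[p_n]\in K_0(C^*_r(G))$ satisfies $$\tau_*([p_n])=\beta^n_{(2)}(G).$$ In particular, if $\beta^n_{(2)}(G)\neq 0$ then $[p_n]\neq 0$ in $K_0(C^*_r(G))$. -/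

import Mathlib

open scoped Matrix Simplicial
open CategoryTheory

universe u v

noncomputable section

namespace HigherKazhdan

/-! ### `K₀` of a unital `*`-algebra through projections in matrix algebras -/

section KTheory

variable (A : Type u) [Ring A] [StarRing A]

/-- A projection `p = p* = p²` in some matrix algebra `M_k(A)`. -/
structure MatProj where
  size : ℕ
  mat : Matrix (Fin size) (Fin size) A
  isProj : IsStarProjection mat

variable {A}

/-- Murray–von Neumann equivalence of projections in matrix algebras of possibly different sizes:
`p = v v*` and `q = v* v` for a rectangular matrix `v`. -/
def MvN (p q : MatProj A) : Prop :=
  ∃ w : Matrix (Fin p.size) (Fin q.size) A, w * wᴴ = p.mat ∧ wᴴ * w = q.mat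

theorem MvN.refl (p : MatProj A) : MvN p p := by
  refine ⟨p.mat, ?_, ?_⟩ <;>
  · have h1 := p.isProj.isSelfAdjoint.star_eq
    have h2 := p.isProj.isIdempotentElem.eq
    rw [Matrix.star_eq_conjTranspose] at h1
    rw [h1, h2]

theorem MvN.symm {p q : MatProj A} : MvN p q → MvN q p := by
  rintro ⟨w, h1, h2⟩
  exact ⟨wᴴ, by simpa using h2, by simpa using h1⟩

theorem MvN.trans {p q r : MatProj A} : MvN p q → MvN q r → MvN p r := by
  rintro ⟨v, h1, h2⟩ ⟨w, h3, h4⟩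
  refine ⟨v * w, ?_, ?_⟩
  · calc v * w * (v * w)ᴴ = v * (w * wᴴ) * vᴴ := by
          rw [Matrix.conjTranspose_mul]; simp only [Matrix.mul_assoc]
      _ = (v * vᴴ) * (v * vᴴ) := by rw [h3, ← h2]; simp only [Matrix.mul_assoc]
      _ = p.mat := by rw [h1, p.isProj.isIdempotentElem.eq]
  · calc (v * w)ᴴ * (v * w) = wᴴ * (vᴴ * v) * w := by
          rw [Matrix.conjTranspose_mul]; simp only [Matrix.mul_assoc]
      _ = (wᴴ * w) * (wᴴ * w) := by rw [h2, ← h3]; simp only [Matrix.mul_assoc]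
      _ = r.mat := by rw [h4, r.isProj.isIdempotentElem.eq]

instance MatProj.setoid : Setoid (MatProj A) :=
  ⟨MvN, MvN.refl, MvN.symm, MvN.trans⟩

/-- The block sum `p ⊕ q`. -/
def MatProj.add (p q : MatProj A) : MatProj A where
  size := p.size + q.size
  mat := (Matrix.fromBlocks p.mat 0 0 q.mat).submatrix finSumFinEquiv.symm finSumFinEquiv.symm
  isProj := by
    have hp1 := p.isProj.isSelfAdjoint.star_eq
    have hp2 := p.isProj.isIdempotentElem.eq
    have hq1 := q.isProj.isSelfAdjoint.star_eq
    have hq2 := q.isProj.isIdempotentElem.eq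
    rw [Matrix.star_eq_conjTranspose] at hp1 hq1
    constructor
    · rw [IsIdempotentElem, Matrix.submatrix_mul_equiv, Matrix.fromBlocks_multiply]
      simp [hp2, hq2]
    · rw [IsSelfAdjoint, Matrix.star_eq_conjTranspose, Matrix.conjTranspose_submatrix,
        Matrix.fromBlocks_conjTranspose]
      simp [hp1, hq1]

/-- The zero projection of size `0`. -/
def MatProj.zero : MatProj A where
  size := 0
  mat := 0
  isProj := ⟨by simp [IsIdempotentElem], by simp [IsSelfAdjoint]⟩

/-- The index set of a block sum is the disjoint union of the index sets. -/
def MatProj.sumEquiv (p q : MatProj A) : Fin p.size ⊕ Fin q.size ≃ Fin (p.add q).size :=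
  finSumFinEquiv

theorem MatProj.add_mat (p q : MatProj A) :
    (p.add q).mat.submatrix (p.sumEquiv q) (p.sumEquiv q) = Matrix.fromBlocks p.mat 0 0 q.mat := by
  ext i j
  change Matrix.fromBlocks p.mat 0 0 q.mat (finSumFinEquiv.symm (finSumFinEquiv i))
    (finSumFinEquiv.symm (finSumFinEquiv j)) = _
  simp only [Equiv.symm_apply_apply]

theorem MatProj.add_mat_apply (p q : MatProj A) (i j) :
    (p.add q).mat (p.sumEquiv q i) (p.sumEquiv q j) = Matrix.fromBlocks p.mat 0 0 q.mat i j :=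
  congrFun (congrFun (p.add_mat q) i) j

/-- Equivalence from a partial isometry indexed by other finite types. -/
theorem MvN.of_equiv {m n : Type} [Fintype m] [Fintype n] (p q : MatProj A)
    (e : m ≃ Fin p.size) (f : n ≃ Fin q.size) (w : Matrix m n A)
    (h1 : w * wᴴ = p.mat.submatrix e e) (h2 : wᴴ * w = q.mat.submatrix f f) : MvN p q := by
  refine ⟨w.submatrix e.symm f.symm, ?_, ?_⟩
  · rw [Matrix.conjTranspose_submatrix, Matrix.submatrix_mul_equiv, h1]
    simp
  · rw [Matrix.conjTranspose_submatrix, Matrix.submatrix_mul_equiv, h2]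
    simp

theorem MvN.add {p p' q q' : MatProj A} : MvN p p' → MvN q q' → MvN (p.add q) (p'.add q') := by
  rintro ⟨v, h1, h2⟩ ⟨w, h3, h4⟩
  refine MvN.of_equiv _ _ (p.sumEquiv q) (p'.sumEquiv q') (Matrix.fromBlocks v 0 0 w) ?_ ?_
  · rw [Matrix.fromBlocks_conjTranspose, Matrix.fromBlocks_multiply, MatProj.add_mat]
    simp [h1, h3]
  · rw [Matrix.fromBlocks_conjTranspose, Matrix.fromBlocks_multiply, MatProj.add_mat]
    simp [h2, h4]

/-- Projections that agree up to a bijection of the index sets are equivalent. -/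
theorem MvN.of_reindex {m : Type} [Fintype m] (p q : MatProj A) (e : m ≃ Fin p.size)
    (f : m ≃ Fin q.size) (h : ∀ i j, p.mat (e i) (e j) = q.mat (f i) (f j)) : MvN p q := by
  have h1 := q.isProj.isSelfAdjoint.star_eq
  have h2 := q.isProj.isIdempotentElem.eq
  rw [Matrix.star_eq_conjTranspose] at h1
  have h' : p.mat.submatrix e e = q.mat.submatrix f f := by ext i j; exact h i j
  refine MvN.of_equiv p q e f (q.mat.submatrix f f) ?_ ?_
  · rw [Matrix.conjTranspose_submatrix, Matrix.submatrix_mul_equiv, h1, h2, h']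
  · rw [Matrix.conjTranspose_submatrix, Matrix.submatrix_mul_equiv, h1, h2]

theorem MvN.add_comm (p q : MatProj A) : MvN (p.add q) (q.add p) := by
  refine MvN.of_reindex _ _ (p.sumEquiv q) ((Equiv.sumComm _ _).trans (q.sumEquiv p)) ?_
  rintro (i | i) (j | j) <;> simp [MatProj.add_mat_apply]

theorem MvN.zero_add (p : MatProj A) : MvN (MatProj.zero.add p) p := by
  have : IsEmpty (Fin (MatProj.zero (A := A)).size) := inferInstanceAs (IsEmpty (Fin 0))
  refine MvN.of_reindex _ _ (MatProj.zero.sumEquiv p) (Equiv.emptySum _ _) ?_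
  rintro (i | i) (j | j)
  · exact isEmptyElim i
  · exact isEmptyElim i
  · exact isEmptyElim j
  · simp [MatProj.add_mat_apply]

theorem MvN.add_assoc (p q r : MatProj A) : MvN ((p.add q).add r) (p.add (q.add r)) := by
  refine MvN.of_reindex _ _
    ((Equiv.sumCongr (p.sumEquiv q) (Equiv.refl _)).trans ((p.add q).sumEquiv r))
    ((Equiv.sumAssoc _ _ _).trans
      ((Equiv.sumCongr (Equiv.refl _) (q.sumEquiv r)).trans (p.sumEquiv (q.add r)))) ?_
  rintro ((i | i) | i) ((j | j) | j) <;> simp [MatProj.add_mat_apply]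

variable (A) in
/-- The monoid of Murray–von Neumann classes of projections in matrix algebras over `A`. -/
def ProjClass : Type u := Quotient (MatProj.setoid (A := A))

instance : Add (ProjClass A) :=
  ⟨Quotient.map₂ MatProj.add fun _ _ h _ _ h' => MvN.add h h'⟩

instance : Zero (ProjClass A) := ⟨Quotient.mk _ MatProj.zero⟩

instance : AddCommMonoid (ProjClass A) where
  nsmul := nsmulRec
  add_assoc := by
    rintro ⟨p⟩ ⟨q⟩ ⟨r⟩; exact Quotient.sound (MvN.add_assoc p q r)
  add_comm := by
    rintro ⟨p⟩ ⟨q⟩; exact Quotient.sound (MvN.add_comm p q)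
  zero_add := by
    rintro ⟨p⟩; exact Quotient.sound (MvN.zero_add p)
  add_zero := by
    rintro ⟨p⟩
    exact Quotient.sound ((MvN.add_comm p MatProj.zero).trans (MvN.zero_add p))

variable (A) in
/-- `K₀(A)`: the Grothendieck group of the monoid of classes of projections over `A`. -/
abbrev K0 : Type u := Algebra.GrothendieckAddGroup (ProjClass A)

/-- The class `[p] ∈ K₀(A)` of a projection `p ∈ M_k(A)`. -/
def K0.mk {k : ℕ} (p : Matrix (Fin k) (Fin k) A) (hp : IsStarProjection p) : K0 A :=
  Algebra.GrothendieckAddGroup.of (Quotient.mk _ ⟨k, p, hp⟩ : ProjClass A)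

/-- A trace on `A`: an additive functional with `τ (a b) = τ (b a)`. -/
structure Tracial (τ : A →+ ℂ) : Prop where
  comm : ∀ a b, τ (a * b) = τ (b * a)

theorem Tracial.matrix_comm {τ : A →+ ℂ} (hτ : Tracial τ) {k l : ℕ}
    (v : Matrix (Fin k) (Fin l) A) (w : Matrix (Fin l) (Fin k) A) :
    ∑ i, τ ((v * w) i i) = ∑ j, τ ((w * v) j j) := by
  simp only [Matrix.mul_apply, map_sum]
  rw [Finset.sum_comm]
  simp only [hτ.comm]

/-- The homomorphism `τ_* : K₀(A) → ℝ` with `τ_* [p] = ∑ i, τ (p i i)`. (For the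
canonical trace of `C*_r(G)` the sum is real when `p` is a projection; the real part only turns it
into an element of `ℝ`.) -/
def K0.trace (τ : A →+ ℂ) (hτ : Tracial τ) : K0 A →+ ℝ :=
  Algebra.GrothendieckAddGroup.lift
    { toFun := Quotient.lift (fun p : MatProj A => (∑ i, τ (p.mat i i)).re) (by
        rintro p q ⟨w, h1, h2⟩
        simp only [← h1, ← h2, hτ.matrix_comm w wᴴ])
      map_zero' := by
        change (∑ i : Fin 0, τ _).re = 0
        simp
      map_add' := by
        rintro ⟨p⟩ ⟨q⟩
        change (∑ i : Fin (p.size + q.size), τ ((p.add q).mat i i)).re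
          = (∑ i, τ (p.mat i i)).re + (∑ i, τ (q.mat i i)).re
        have h : ∑ i, τ ((p.add q).mat i i) = ∑ i, τ (p.mat i i) + ∑ i, τ (q.mat i i) := by
          rw [← Equiv.sum_comp (p.sumEquiv q)]
          simp [MatProj.add_mat_apply]
        rw [← Complex.add_re, ← h]
        rfl }

theorem K0.trace_mk (τ : A →+ ℂ) (hτ : Tracial τ) {k : ℕ} (p : Matrix (Fin k) (Fin k) A)
    (hp : IsStarProjection p) : K0.trace τ hτ (K0.mk p hp) = (∑ i, τ (p i i)).re := by
  exact AddSubmonoid.LocalizationMap.lift_eq _ _ _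

end KTheory

/-! ### The reduced group `C*`-algebra and its canonical trace -/

section Reduced

/-- The Hilbert space `ℓ²(G)`. -/
abbrev Ell2 (G : Type u) : Type u := lp (fun _ : G => ℂ) 2

variable {G : Type u}

/-- The unitary operator `f ↦ f ∘ e⁻¹` on `ℓ²(G)` of a permutation `e` of `G`. -/
def permIsom (e : Equiv.Perm G) : Ell2 G →ₗᵢ[ℂ] Ell2 G where
  toFun f := ⟨fun x => f (e.symm x), by
    have h := (lp.memℓp f).summable (by norm_num)
    exact memℓp_gen ((e.symm.summable_iff (f := fun i => ‖f i‖ ^ (2 : ENNReal).toReal)).2 h)⟩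
  map_add' f g := by ext; rfl
  map_smul' c f := by ext; rfl
  norm_map' f := by
    rw [lp.norm_eq_tsum_rpow (by norm_num), lp.norm_eq_tsum_rpow (by norm_num)]
    congr 1
    exact e.symm.tsum_eq (fun i => ‖f i‖ ^ (2 : ENNReal).toReal)

def permOp (e : Equiv.Perm G) : Ell2 G →L[ℂ] Ell2 G := (permIsom e).toContinuousLinearMap

theorem permOp_apply (e : Equiv.Perm G) (f : Ell2 G) (x : G) : permOp e f x = f (e.symm x) := rfl

variable [Group G]

variable (G) in
/-- The left regular representation, `(λ_g f)(x) = f (g⁻¹ x)`. -/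
def leftRegular : G →* (Ell2 G →L[ℂ] Ell2 G) where
  toFun g := permOp (Equiv.mulLeft g)
  map_one' := by
    ext f x
    change f (1⁻¹ * x) = f x
    simp
  map_mul' g h := by
    ext f x
    change f ((g * h)⁻¹ * x) = f (h⁻¹ * (g⁻¹ * x))
    simp [mul_assoc]

theorem leftRegular_apply (g : G) (f : Ell2 G) (x : G) : leftRegular G g f x = f (g⁻¹ * x) := rfl

variable (G) in
/-- The reduced group `C*`-algebra: the norm closure in `B(ℓ²(G))` of the `*`-algebra `λ(ℂG)`
generated by the operators `λ_g`. -/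
def ReducedCStar : StarSubalgebra ℂ (Ell2 G →L[ℂ] Ell2 G) :=
  (StarAlgebra.adjoin ℂ (Set.range (leftRegular G))).topologicalClosure

theorem leftRegular_mem (g : G) : leftRegular G g ∈ ReducedCStar G :=
  StarSubalgebra.le_topologicalClosure _ (StarAlgebra.subset_adjoin ℂ _ ⟨g, rfl⟩)

variable (G) in
/-- The map `ℂG → C*_r(G)`. -/
def groupRingMap : MonoidAlgebra ℂ G →ₐ[ℂ] ReducedCStar G :=
  MonoidAlgebra.lift ℂ (ReducedCStar G) G
    { toFun := fun g => ⟨leftRegular G g, leftRegular_mem g⟩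
      map_one' := Subtype.ext (map_one (leftRegular G))
      map_mul' := fun g h => Subtype.ext (map_mul (leftRegular G) g h) }

open Classical in
/-- The Dirac function `δ_g ∈ ℓ²(G)`. -/
def dirac (g : G) : Ell2 G := lp.single 2 g (1 : ℂ)

theorem inner_dirac (g : G) (f : Ell2 G) : inner ℂ (dirac g) f = f g := by
  simp [dirac, lp.inner_single_left]

variable (G) in
/-- The canonical trace `τ_G(a) = ⟨a δ_e, δ_e⟩` on `C*_r(G)`. (Mathlib's inner product is
linear in its second argument.) -/
def canonicalTrace : ReducedCStar G →+ ℂ where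
  toFun a := inner ℂ (dirac (1 : G)) ((a : Ell2 G →L[ℂ] Ell2 G) (dirac 1))
  map_zero' := by simp
  map_add' a b := by simp

/-- Elements of `C*_r(G)` commute with right translations. -/
theorem reduced_commute (a : ReducedCStar G) (h : G) :
    permOp (Equiv.mulRight h) * (a : Ell2 G →L[ℂ] Ell2 G) = a * permOp (Equiv.mulRight h) := by
  have hstar : ∀ e : Equiv.Perm G, star (permOp e) = permOp e.symm := by
    intro e
    rw [ContinuousLinearMap.star_eq_adjoint, eq_comm, ContinuousLinearMap.eq_adjoint_iff]
    intro x y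
    rw [lp.inner_eq_tsum, lp.inner_eq_tsum, ← Equiv.tsum_eq e.symm]
    simp [permOp_apply]
  have hle : ReducedCStar G ≤
      StarSubalgebra.centralizer ℂ (Set.range fun h : G => permOp (Equiv.mulRight h)) := by
    refine StarSubalgebra.topologicalClosure_minimal ?_ ?_
    · refine StarAlgebra.adjoin_le ?_
      rintro _ ⟨g, rfl⟩
      rw [SetLike.mem_coe, StarSubalgebra.mem_centralizer_iff]
      rintro _ ⟨h, rfl⟩
      constructor
      · ext f x
        simp [permOp_apply, leftRegular_apply, mul_assoc]
      · rw [hstar]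
        ext f x
        simp [permOp_apply, leftRegular_apply, mul_assoc]
    · have : (StarSubalgebra.centralizer ℂ
          (Set.range fun h : G => permOp (Equiv.mulRight h)) : Set (Ell2 G →L[ℂ] Ell2 G)) =
          Set.centralizer (Set.range (fun h : G => permOp (Equiv.mulRight h)) ∪
            star (Set.range fun h : G => permOp (Equiv.mulRight h))) := rfl
      rw [this]
      exact Set.isClosed_centralizer _
  exact ((StarSubalgebra.mem_centralizer_iff ℂ).1 (hle a.2) _ ⟨h, rfl⟩).1

theorem reduced_apply_dirac (a : ReducedCStar G) (h : G) :
    (a : Ell2 G →L[ℂ] Ell2 G) (dirac h) 1 = (a : Ell2 G →L[ℂ] Ell2 G) (dirac 1) h⁻¹ := by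
  have h1 : dirac h = permOp (Equiv.mulRight h) (dirac (1 : G)) := by
    ext x
    rw [permOp_apply]
    rcases eq_or_ne x h with rfl | hx
    · simp [dirac]
    · have : x * h⁻¹ ≠ 1 := fun h' => hx (mul_inv_eq_one.1 h')
      simp [dirac, hx, this]
  have h2 := congrArg (fun T : Ell2 G →L[ℂ] Ell2 G => T (dirac 1) 1) (reduced_commute a h)
  simp only [mul_apply_eq_comp] at h2
  rw [h1, ← h2, permOp_apply]
  simp

theorem canonicalTrace_mul (a b : ReducedCStar G) :
    canonicalTrace G (a * b) = ∑' h : G,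
      (a : Ell2 G →L[ℂ] Ell2 G) (dirac 1) h⁻¹ * (b : Ell2 G →L[ℂ] Ell2 G) (dirac 1) h := by
  change inner ℂ (dirac (1 : G)) ((a : Ell2 G →L[ℂ] Ell2 G)
    ((b : Ell2 G →L[ℂ] Ell2 G) (dirac 1))) = _
  rw [← ContinuousLinearMap.adjoint_inner_left, lp.inner_eq_tsum]
  refine tsum_congr fun h => ?_
  have : (ContinuousLinearMap.adjoint (a : Ell2 G →L[ℂ] Ell2 G)) (dirac 1) h
      = starRingEnd ℂ ((a : Ell2 G →L[ℂ] Ell2 G) (dirac 1) h⁻¹) := by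
    rw [← reduced_apply_dirac, ← inner_dirac h, ContinuousLinearMap.adjoint_inner_right,
      ← inner_conj_symm, inner_dirac]
  rw [this]
  simp [mul_comm]

variable (G) in
theorem canonicalTrace_tracial : Tracial (canonicalTrace G) where
  comm a b := by
    rw [canonicalTrace_mul, canonicalTrace_mul, ← (Equiv.inv G).tsum_eq]
    refine tsum_congr fun h => ?_
    simp [mul_comm]

variable (G) in
/-- The map `τ_* : K₀(C*_r(G)) → ℝ` induced by the canonical trace. -/
def traceK0 : K0 (ReducedCStar G) →+ ℝ := K0.trace (canonicalTrace G) (canonicalTrace_tracial G)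

variable (G) in
/-- The Hilbert space `ℓ²(G)^k`. -/
abbrev Ell2Pow (k : ℕ) : Type u := PiLp 2 (fun _ : Fin k => Ell2 G)

/-- The operator `ℓ²(G)^k → ℓ²(G)^l` given by an `l × k` matrix over `C*_r(G)`:
`(M f)_i = ∑ j, M i j f_j`. -/
def matOp {k l : ℕ} (M : Matrix (Fin l) (Fin k) (ReducedCStar G)) :
    Ell2Pow G k →L[ℂ] Ell2Pow G l :=
  (PiLp.continuousLinearEquiv 2 ℂ (fun _ : Fin l => Ell2 G)).symm.toContinuousLinearMap.comp
    (ContinuousLinearMap.pi fun i => ∑ j,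
      (M i j : Ell2 G →L[ℂ] Ell2 G).comp (PiLp.proj 2 (fun _ : Fin k => Ell2 G) j))

theorem matOp_apply {k l : ℕ} (M : Matrix (Fin l) (Fin k) (ReducedCStar G)) (f : Ell2Pow G k)
    (i : Fin l) : matOp M f i = ∑ j, (M i j : Ell2 G →L[ℂ] Ell2 G) (f j) := by
  simp [matOp]

/-- The trace `∑ i, ⟨T_ii δ_e, δ_e⟩` of a bounded operator on `ℓ²(G)^k`; on the matrix algebra
`M_k(L(G))` over the group von Neumann algebra this is the von Neumann trace. -/
def vonNeumannTrace {k : ℕ} (T : Ell2Pow G k →L[ℂ] Ell2Pow G k) : ℂ :=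
  ∑ i, inner ℂ (WithLp.toLp 2 (Pi.single i (dirac (1 : G))) : Ell2Pow G k)
    (T (WithLp.toLp 2 (Pi.single i (dirac (1 : G)))))

/-- The von Neumann dimension over `L(G)` of a closed (right-translation-invariant) subspace of
`ℓ²(G)^k`: the von Neumann trace of the orthogonal projection onto it, a real number. -/
def vonNeumannDim {k : ℕ} (V : Submodule ℂ (Ell2Pow G k)) [V.HasOrthogonalProjection] : ℝ :=
  (vonNeumannTrace V.starProjection).re

end Reduced

/-! ### Models of `K(G,1)`, cochains, Laplacians -/

section Model

/-- A simplicial model `X` of `K(G,1)` with finite `(n+1)`-skeleton. It is given by its universal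
cover `E`, a simplicial set with contractible realization on which `G` acts freely, so that
`X = E / G`, together with a lift to `E` of each (nondegenerate) simplex of `X` of dimension at
most `n + 1`. -/
structure EMModel (G : Type u) [Group G] (n : ℕ) where
  /-- the universal cover of `X` -/
  E : SSet.{v}
  contractible : ContractibleSpace (SSet.toTop.obj E)
  /-- the action of `G` by deck transformations -/
  act : G →* Aut E
  free : ∀ (g : G) (m : ℕ) (σ : E _⦋m⦌), (act g).hom.app (Opposite.op ⦋m⦌) σ = σ → g = 1
  /-- the number of `m`-simplices of `X`, for `m ≤ n + 1` -/
  k : ℕ → ℕ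
  /-- the chosen lifts of the `m`-simplices of `X`, for `m ≤ n + 1` -/
  cell : (m : ℕ) → Fin (k m) → E _⦋m⦌
  cell_nonDegenerate : ∀ m ≤ n + 1, ∀ j, cell m j ∈ E.nonDegenerate m
  cell_orbit : ∀ m ≤ n + 1, ∀ σ ∈ E.nonDegenerate m,
    ∃! j, ∃ g, (act g).hom.app (Opposite.op ⦋m⦌) (cell m j) = σ

namespace EMModel

variable {G : Type u} [Group G] {n : ℕ} (X : EMModel.{u, v} G n)

open Classical in
/-- The element `g ∈ ℂG` if `σ = g • cell m j` (such a `g` is unique, as the action is free), and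
`0` if there is no such `g`. -/
def coeff {m : ℕ} (σ : X.E _⦋m⦌) (j : Fin (X.k m)) : MonoidAlgebra ℂ G :=
  if h : ∃ g, (X.act g).hom.app (Opposite.op ⦋m⦌) (X.cell m j) = σ then
    MonoidAlgebra.single h.choose 1 else 0

/-- The codifferential `d_m ∈ M_{k_{m+1} × k_m}(ℂG)`. An `m`-cochain with coefficients in a
representation `π` is a map on the chosen lifts of `m`-simplices, extended to `E` by
`f (g • σ) = π(g) (f σ)` and by `0` on degenerate simplices, and
`(d f)(σ) = ∑ i, (-1)^i f (∂_i σ)`. -/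
def d (m : ℕ) : Matrix (Fin (X.k (m + 1))) (Fin (X.k m)) (MonoidAlgebra ℂ G) :=
  fun s t => ∑ i : Fin (m + 2), (-1 : MonoidAlgebra ℂ G) ^ (i : ℕ) *
    X.coeff (X.E.δ i (X.cell (m + 1) s)) t

/-- `d_m` as a matrix over `C*_r(G)`. -/
def dRed (m : ℕ) : Matrix (Fin (X.k (m + 1))) (Fin (X.k m)) (ReducedCStar G) :=
  (X.d m).map (groupRingMap G)

/-- `Δ_m⁺ = d_m* d_m`. -/
def laplacianPlus (m : ℕ) : Matrix (Fin (X.k m)) (Fin (X.k m)) (ReducedCStar G) :=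
  (X.dRed m)ᴴ * X.dRed m

/-- `Δ_m⁻ = d_{m-1} d_{m-1}*`, where `d_{-1} = 0`. -/
def laplacianMinus : (m : ℕ) → Matrix (Fin (X.k m)) (Fin (X.k m)) (ReducedCStar G) :=
  fun m => match m with
    | 0 => 0
    | m + 1 => X.dRed m * (X.dRed m)ᴴ

/-- The Laplacian `Δ_n = d_n* d_n + d_{n-1} d_{n-1}*` in `M_{k_n}(C*_r(G))`. -/
def laplacian : Matrix (Fin (X.k n)) (Fin (X.k n)) (ReducedCStar G) :=
  X.laplacianPlus n + X.laplacianMinus n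

/-- The spectrum of `Δ_n` in `M_{k_n}(C*_r(G))` is contained in `{0} ∪ [ε, ∞)` for some `ε > 0`. -/
def HasSpectralGap : Prop :=
  ∃ ε : ℝ, 0 < ε ∧ spectrum ℂ X.laplacian ⊆ (fun x : ℝ => (x : ℂ)) '' ({0} ∪ Set.Ici ε)

/-- The space `ker λ(Δ_n)` of harmonic `ℓ²`-cochains of degree `n`. -/
abbrev harmonic : Submodule ℂ (Ell2Pow G (X.k n)) := (matOp X.laplacian).ker

/-- A Kazhdan projection in degree `n` over `C*_r(G)`: a projection `p ∈ M_{k_n}(C*_r(G))` such that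
`λ(p)` is the orthogonal projection `C^n(G, λ) → ker λ(Δ_n)`. -/
structure IsKazhdanProjection (p : Matrix (Fin (X.k n)) (Fin (X.k n)) (ReducedCStar G)) :
    Prop where
  isProj : IsStarProjection p
  matOp_eq : matOp p = X.harmonic.starProjection

/-- The `ℓ²`-Betti number `β^n_(2)(G)`: the von Neumann dimension over `L(G)` of the kernel of the
Laplacian `λ(Δ_n)`. -/
def l2Betti : ℝ := vonNeumannDim X.harmonic

end EMModel

end Model

end HigherKazhdan

end

/-!
By the spectral gap, `0` is at most an isolated point of the spectrum of the self-adjoint matrix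
`Δ_n`. Hence the indicator function of
`{0}` and the function `x ↦ x⁻¹` (with value `0` at `0`) are both continuous on that spectrum, so
the continuous functional calculus of the `C*`-algebra `M_k(C*_r(G))` yields a projection `p` and
an element `b` with `Δ_n p = 0` and `1 - p = Δ_n b`
(`exists_isStarProjection_reducedCStar_of_spectrum_gap`).

On `ℓ²(G)^k` the first identity says that `p` maps into `ker Δ_n`. The second says that
`f - p f = Δ_n (b f)` lies in the range of the self-adjoint operator `Δ_n`, hence is orthogonal to
`ker Δ_n`. So `p` acts as the orthogonal projection onto `ker Δ_n` (`matOp_eq_starProjection_ker`).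
Uniqueness holds because a matrix over `C*_r(G)` is determined by its operator on `ℓ²(G)^k`
(`matOp_injective`).

The value of `τ_*` on `[p]` is the von Neumann trace of the operator of `p`
(`vonNeumannTrace_matOp`), that is, of the orthogonal projection onto `ker Δ_n`, and this trace is
the `ℓ²`-Betti number by definition. Since `τ_*` is a homomorphism, `[p] = 0` forces the Betti
number to vanish.
-/

namespace HigherKazhdan

/-- The spectral projection `p` of `a` at `0` (which is `0` if `a` is invertible). The element `b` is
the inverse of `a` in the complementary corner, and witnesses that `1 - p` lies in the range
of `a`. -/
theorem exists_isStarProjection_of_spectrum_gap {B : Type*} [CStarAlgebra B] {a : B}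
    (ha : IsSelfAdjoint a) {ε : ℝ} (hε : 0 < ε)
    (hspec : spectrum ℂ a ⊆ (fun x : ℝ => (x : ℂ)) '' ({0} ∪ Set.Ici ε)) :
    ∃ p b : B, IsStarProjection p ∧ a * p = 0 ∧ 1 - p = a * b := by
  have hgap : spectrum ℝ a ⊆ {0} ∪ Set.Ici ε := by
    intro x hx
    obtain ⟨y, hy, hyx⟩ := hspec ((spectrum.algebraMap_mem_iff ℂ).2 hx)
    have hyx : y = x := Complex.ofReal_injective hyx
    exact hyx ▸ hy
  -- On `{0} ∪ [ε, ∞)` the indicator of `0` agrees with a continuous ramp that vanishes on `[ε, ∞)`.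
  have hχ : ContinuousOn (fun x : ℝ => if x = 0 then (1 : ℝ) else 0) (spectrum ℝ a) := by
    have hc : Continuous fun x : ℝ => max 0 (1 - |x| / ε) := by fun_prop
    refine hc.continuousOn.congr fun x hx => ?_
    rcases hgap hx with rfl | hx
    · simp
    · have hx : ε ≤ x := hx
      have h1 : 1 ≤ |x| / ε := by
        rw [one_le_div hε]; exact hx.trans (le_abs_self x)
      rw [if_neg (hε.trans_le hx).ne']
      exact (max_eq_left (by linarith)).symm
  -- The same for `x⁻¹`: the function `x / max (ε², x²)` is continuous, vanishes at `0`, and equals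
  -- `x⁻¹` on `[ε, ∞)`.
  have hinv : ContinuousOn (fun x : ℝ => x⁻¹) (spectrum ℝ a) := by
    have hc : Continuous fun x : ℝ => x * (max (ε ^ 2) (x ^ 2))⁻¹ :=
      continuous_id.mul (Continuous.inv₀ (by fun_prop)
        fun x => ((pow_pos hε 2).trans_le (le_max_left _ _)).ne')
    refine hc.continuousOn.congr fun x hx => ?_
    rcases hgap hx with rfl | hx
    · simp
    · have hx : ε ≤ x := hx
      have hx0 : x ≠ 0 := (hε.trans_le hx).ne'
      change x⁻¹ = x * (max (ε ^ 2) (x ^ 2))⁻¹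
      rw [max_eq_right (by gcongr)]
      field_simp
  -- At `0` the convention `0⁻¹ = 0` is what makes `x * x⁻¹` the indicator of `x ≠ 0`.
  refine ⟨cfc (fun x : ℝ => if x = 0 then (1 : ℝ) else 0) a, cfc (fun x : ℝ => x⁻¹) a,
    ⟨?_, cfc_predicate _ a⟩, ?_, ?_⟩
  · rw [IsIdempotentElem, ← cfc_mul _ _ a hχ hχ]
    congr 1
    ext x
    split_ifs <;> simp
  · nth_rewrite 1 [← cfc_id ℝ a]
    rw [← cfc_mul _ _ a continuousOn_id hχ, ← cfc_zero ℝ a]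
    congr 1
    ext x
    by_cases hx : x = 0 <;> simp [hx]
  · nth_rewrite 2 [← cfc_id ℝ a]
    rw [← cfc_mul _ _ a continuousOn_id hinv, ← cfc_const_one ℝ a,
      ← cfc_sub _ _ a continuousOn_const hχ]
    congr 1
    ext x
    by_cases hx : x = 0 <;> simp [hx]

-- The `C*`-norm on `CStarMatrix` requires a star-ordered `A`; the spectral order provides this.
attribute [local instance] CStarAlgebra.spectralOrder CStarAlgebra.spectralOrderedRing in
theorem exists_isStarProjection_matrix_of_spectrum_gap {A m : Type*} [CStarAlgebra A] [Fintype m]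
    [DecidableEq m] {M : Matrix m m A} (hM : IsSelfAdjoint M) {ε : ℝ} (hε : 0 < ε)
    (hspec : spectrum ℂ M ⊆ (fun x : ℝ => (x : ℂ)) '' ({0} ∪ Set.Ici ε)) :
    ∃ p b : Matrix m m A, IsStarProjection p ∧ M * p = 0 ∧ 1 - p = M * b := by
  let e : Matrix m m A ≃⋆ₐ[ℂ] CStarMatrix m m A := CStarMatrix.ofMatrixStarAlgEquiv
  obtain ⟨p, b, hp, hMp, hb⟩ := exists_isStarProjection_of_spectrum_gap (hM.map e) hε
    ((AlgEquiv.spectrum_eq e M).trans_subset hspec)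
  refine ⟨e.symm p, e.symm b, hp.map e.symm, ?_, ?_⟩
  · apply EquivLike.injective e
    rw [map_mul, e.apply_symm_apply, map_zero, hMp]
  · apply EquivLike.injective e
    rw [map_sub, map_one, map_mul, e.apply_symm_apply, e.apply_symm_apply, hb]

section MatOp

variable {G : Type u} [Group G]

theorem matOp_mul {k l m : ℕ} (M : Matrix (Fin m) (Fin l) (ReducedCStar G))
    (N : Matrix (Fin l) (Fin k) (ReducedCStar G)) (f : Ell2Pow G k) :
    matOp (M * N) f = matOp M (matOp N f) := by
  ext1 i
  simp only [matOp_apply, Matrix.mul_apply, map_sum, AddSubmonoidClass.coe_finsetSum,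
    MulMemClass.coe_mul, _root_.sum_apply, mul_apply_eq_comp]
  exact Finset.sum_comm

theorem matOp_zero {k l : ℕ} :
    matOp (0 : Matrix (Fin l) (Fin k) (ReducedCStar G)) = 0 := by
  ext1 f
  ext1 i
  simp [matOp_apply]

theorem matOp_one_sub {k : ℕ} (M : Matrix (Fin k) (Fin k) (ReducedCStar G)) (f : Ell2Pow G k) :
    matOp (1 - M) f = f - matOp M f := by
  ext1 i
  have h : ∀ j, ((1 : Matrix (Fin k) (Fin k) (ReducedCStar G)) i j : Ell2 G →L[ℂ] Ell2 G) (f j)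
      = if i = j then f j else 0 := by
    intro j
    rw [Matrix.one_apply]
    split_ifs <;> simp
  simp [matOp_apply, Finset.sum_sub_distrib, h]

/-- The operator of `Mᴴ` is the adjoint of the operator of `M`. -/
theorem inner_matOp_left {k l : ℕ} (M : Matrix (Fin l) (Fin k) (ReducedCStar G))
    (f : Ell2Pow G k) (g : Ell2Pow G l) :
    inner ℂ (matOp M f) g = inner ℂ f (matOp Mᴴ g) := by
  simp only [PiLp.inner_apply, matOp_apply, sum_inner, inner_sum, Matrix.conjTranspose_apply,
    StarMemClass.coe_star, ContinuousLinearMap.star_eq_adjoint,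
    ContinuousLinearMap.adjoint_inner_right]
  exact Finset.sum_comm

theorem matOp_single {k l : ℕ} (M : Matrix (Fin l) (Fin k) (ReducedCStar G)) (j : Fin k)
    (f : Ell2 G) (i : Fin l) :
    matOp M (WithLp.toLp 2 (Pi.single j f)) i = (M i j : Ell2 G →L[ℂ] Ell2 G) f := by
  rw [matOp_apply, Finset.sum_eq_single j]
  · simp
  · intro b _ hb
    simp [hb]
  · simp

theorem matOp_injective {k l : ℕ} :
    Function.Injective (matOp (G := G) : Matrix (Fin l) (Fin k) (ReducedCStar G) → _) := by
  intro M N h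
  ext1 i j
  refine Subtype.ext (ContinuousLinearMap.ext fun f => ?_)
  rw [← matOp_single, ← matOp_single, h]

theorem vonNeumannTrace_matOp {k : ℕ} (M : Matrix (Fin k) (Fin k) (ReducedCStar G)) :
    vonNeumannTrace (matOp M) = ∑ i, canonicalTrace G (M i i) := by
  refine Finset.sum_congr rfl fun i _ => ?_
  rw [PiLp.inner_apply, Finset.sum_eq_single i]
  · rw [matOp_single]
    simp [canonicalTrace]
  · intro b _ hb
    simp [hb]
  · simp

theorem exists_isStarProjection_reducedCStar_of_spectrum_gap {k : ℕ}
    {M : Matrix (Fin k) (Fin k) (ReducedCStar G)} (hM : IsSelfAdjoint M) {ε : ℝ} (hε : 0 < ε)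
    (hspec : spectrum ℂ M ⊆ (fun x : ℝ => (x : ℂ)) '' ({0} ∪ Set.Ici ε)) :
    ∃ p b : Matrix (Fin k) (Fin k) (ReducedCStar G),
      IsStarProjection p ∧ M * p = 0 ∧ 1 - p = M * b := by
  have : IsClosed (ReducedCStar G : Set (Ell2 G →L[ℂ] Ell2 G)) :=
    StarSubalgebra.isClosed_topologicalClosure _
  exact exists_isStarProjection_matrix_of_spectrum_gap (A := ReducedCStar G) hM hε hspec

end MatOp

theorem EMModel.isSelfAdjoint_laplacian {G : Type u} [Group G] {n : ℕ} (X : EMModel.{u, v} G n) :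
    IsSelfAdjoint X.laplacian := by
  refine IsSelfAdjoint.add (Matrix.isHermitian_conjTranspose_mul_self _) ?_
  cases n with
  | zero => exact IsSelfAdjoint.zero _
  | succ m => exact Matrix.isHermitian_mul_conjTranspose_self _

/-- The identity `1 - p = M b` puts `f - p f` in the range of `M`, which is orthogonal to `ker M`
since `M` is self-adjoint. -/
theorem matOp_eq_starProjection_ker {G : Type u} [Group G] {k : ℕ}
    {M p b : Matrix (Fin k) (Fin k) (ReducedCStar G)} (hM : IsSelfAdjoint M)
    (hp : M * p = 0) (hb : 1 - p = M * b) : matOp p = (matOp M).ker.starProjection := by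
  ext1 f
  symm
  refine Submodule.eq_starProjection_of_mem_orthogonal ?_ ?_
  · change matOp M (matOp p f) = 0
    rw [← matOp_mul, hp, matOp_zero, zero_apply]
  · intro g hg
    have hg : matOp M g = 0 := hg
    rw [← matOp_one_sub, hb, matOp_mul, ← hM.star_eq, Matrix.star_eq_conjTranspose,
      ← inner_matOp_left, hg, inner_zero_left]

end HigherKazhdan

open HigherKazhdan in
theorem mainTheorem3 {G : Type u} [Group G] (n : ℕ) (X : EMModel.{u, v} G n)
    (hgap : X.HasSpectralGap) :
    (∃! p, X.IsKazhdanProjection p) ∧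
    ∀ p (hp : X.IsKazhdanProjection p),
      traceK0 G (K0.mk p hp.isProj) = X.l2Betti ∧
      (X.l2Betti ≠ 0 → K0.mk p hp.isProj ≠ 0) := by
  have htrace : ∀ p (hp : X.IsKazhdanProjection p),
      traceK0 G (K0.mk p hp.isProj) = X.l2Betti := by
    intro p hp
    rw [traceK0, K0.trace_mk, EMModel.l2Betti, vonNeumannDim, ← hp.matOp_eq,
      vonNeumannTrace_matOp]
  obtain ⟨ε, hε, hspec⟩ := hgap
  obtain ⟨p, b, hp, hMp, hb⟩ :=
    exists_isStarProjection_reducedCStar_of_spectrum_gap X.isSelfAdjoint_laplacian hε hspec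
  refine ⟨⟨p, ⟨hp, matOp_eq_starProjection_ker X.isSelfAdjoint_laplacian hMp hb⟩,
    fun q hq => matOp_injective (hq.matOp_eq.trans
      (matOp_eq_starProjection_ker X.isSelfAdjoint_laplacian hMp hb).symm)⟩,
    fun q hq => ⟨htrace q hq, fun hβ h0 => hβ ?_⟩⟩
  rw [← htrace q hq, h0, map_zero]
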